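/- **Setting.** Let $G=(V,E)$ be a finite simple connected graph with source $g_0\in V$, and let $N(u)$ denote the set of neighbours of $u$. A delay function is a map $d:\mathbb N\times V\times E\to\{0,1\}$; $d(j,v,e)=1$ means that in round $j$ transmission from $v$ along its incident edge $e$ is blocked. It has the finite delay property if no incident pair $(v,e)$ is blocked in all rounds from some round on. In Round-Delayed Amnesiac Flooding (RDAF) each node $u$ has in round $j$ a message bit $M(j,u)$ and a destination set $\mathrm{dest}(j,u)$. Initially $M(0,g_0)=1$, $\mathrm{dest}(0,g_0)=N(g_0)$, and $M(0,u)=0$, $\mathrm{dest}(0,u)=\emptyset$ for $u\ne g_0$. Put $$s(j+1,u)=\{v\in N(u): u\in\mathrm{dest}(j,v),\ d(j+1,v,\{v,u\})=0\},$$ $$p(j+1,u)=\{v\in\mathrm{dest}(j,u): d(j+1,u,\{u,v\})=1\}.$$ Then $M(j+1,u)=1$ iff $s(j+1,u)\cup p(j+1,u)\neq\emptyset$; and $\mathrm{dest}(j+1,u)=N(u)\setminus s(j+1,u)$ if $s(j+1,u)\ne\emptyset$, while $\mathrm{dest}(j+1,u)=p(j+1,u)$ otherwise. Flooding terminates if for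 some $t$, $M(t,u)=0$ for all $u\in V$. An eventually periodic adversary (EPA) is a triple $(d,c,l)$ with $c\in\mathbb N$, $l\in\mathbb N^+$ and $d(i,u,e)=d(i+l,u,e)$ for all $i\ge c$, $u\in V$, $e\in E$. A decision procedure for EPA-RDAF termination is a deterministic sequential procedure (with an arbitrary state set and unrestricted internal computation) that is given $G,g_0,c,l$, accesses $d$ by evaluating it at triples $(j,v,e)$, at most one evaluation per step, and that, on every input in which $d$ has the finite delay property, halts and answers correctly whether flooding terminates. Its running time on an input is the number of steps until it halts. **Theorem (Lower Bound).** Any decision procedure for EPA-RDAF termination has worst-case time complexity $\Omega((c+l)\cdot|E|)$. That is, there are constants $\varepsilon>0$ and $k_0\in\mathbb N$ such that for every decision procedure for EPA-RDAF termination and all integers $c\ge 0$, $l\ge 1$, $m\ge 3$ with $c+l\ge k_0$, there is an input, consisting of a connected graph $G$ with $|E|=m$, a source $g_0$, and an EPA $(d,c,l)$ whose $d$ has the finite delay property, on which the procedure takes at least $\varepsilon\,(c+l)\,m$ steps. -/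

import Mathlib

namespace RDAF

/-! ### Networks, delay functions, and the protocol -/

/-- A finite, simple, connected graph with a distinguished source node. -/
structure Network where
  /-- number of nodes; the nodes are `0, …, n - 1` -/
  n : ℕ
  /-- the graph `G = (V, E)` -/
  graph : SimpleGraph (Fin n)
  connected : graph.Connected
  /-- the source node `g₀` -/
  source : Fin n

namespace Network

/-- The node set `V`. -/
abbrev Node (N : Network) : Type := Fin N.n

/-- The edge set `E`, as a type. -/
abbrev Edge (N : Network) : Type := N.graph.edgeSet

/-- `|E|`. -/
noncomputable def edgeCount (N : Network) : ℕ := N.graph.edgeSet.ncard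

end Network

/-- A delay function `d : ℕ × V × E → {0, 1}`; the value `true` (that is, `1`) at `(j, v, e)` means
that in round `j` transmission from `v` along `e` is blocked. -/
abbrev DelayFunction (N : Network) : Type := ℕ → N.Node → N.Edge → Bool

namespace DelayFunction

variable {N : Network}

/-- `{v, u}` is an edge and `d(j, v, {v, u}) = 1`. -/
def Blocked (d : DelayFunction N) (j : ℕ) (v u : N.Node) : Prop :=
  ∃ h : N.graph.Adj v u, d j v ⟨s(v, u), h⟩ = true

/-- `{v, u}` is an edge and `d(j, v, {v, u}) = 0`. -/
def Allowed (d : DelayFunction N) (j : ℕ) (v u : N.Node) : Prop :=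
  ∃ h : N.graph.Adj v u, d j v ⟨s(v, u), h⟩ = false

/-- The finite delay property: for every node and incident edge, there is no infinite run of
consecutive blocked rounds. -/
def FiniteDelay (d : DelayFunction N) : Prop :=
  ∀ v u : N.Node, N.graph.Adj v u → ∀ t : ℕ, ∃ j, t ≤ j ∧ d.Allowed j v u

end DelayFunction

/-- The state record `(M, s, dest)` of a node. -/
structure StateRecord (N : Network) where
  /-- the node possesses the message -/
  hasMsg : Prop
  /-- source set: neighbours that delivered the message in this round -/
  src : Set N.Node
  /-- destination set: neighbours to which the node intends to forward the message -/
  dest : Set N.Node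

variable {N : Network}

/-- The source holds the message for all its neighbours; all other nodes are idle. -/
def initialState (N : Network) (u : N.Node) : StateRecord N where
  hasMsg := u = N.source
  src := ∅
  dest := {v | u = N.source ∧ N.graph.Adj u v}

/-- The nodes that deliver the message to `u` in round `j + 1`, given the states `S` of round `j`. -/
def received (d : DelayFunction N) (j : ℕ) (S : N.Node → StateRecord N) (u : N.Node) :
    Set N.Node :=
  {v | u ∈ (S v).dest ∧ d.Allowed (j + 1) v u}

/-- The destinations to which transmission from `u` is delayed in round `j + 1`, given the states
`S` of round `j`. -/
def pending (d : DelayFunction N) (j : ℕ) (S : N.Node → StateRecord N) (u : N.Node) :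
    Set N.Node :=
  {v | v ∈ (S u).dest ∧ d.Blocked (j + 1) u v}

open Classical in
/-- The state update from round `j` to round `j + 1`. A node that receives the message recomputes
its destination set as all neighbours except those that just delivered; a node that does not
receive keeps exactly its delayed destinations (none, if it does not possess the message). -/
noncomputable def nextState (d : DelayFunction N) (j : ℕ) (S : N.Node → StateRecord N)
    (u : N.Node) : StateRecord N where
  hasMsg := (pending d j S u).Nonempty ∨ (received d j S u).Nonempty
  src := received d j S u
  dest :=
    if (received d j S u).Nonempty then N.graph.neighborSet u \ received d j S u
    else pending d j S u

/-- The system state `S(j, ·)` under the delay function `d`. -/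
noncomputable def state (d : DelayFunction N) : ℕ → N.Node → StateRecord N
  | 0 => initialState N
  | j + 1 => nextState d j (state d j)

/-- Flooding terminates: in some round no node has the message. -/
def Terminates (d : DelayFunction N) : Prop :=
  ∃ t : ℕ, ∀ v : N.Node, ¬ (state d t v).hasMsg

/-- An eventually periodic adversary `(d, c, l)` on a network. (Such a `d` is determined by finitely
many values, so it is automatically computable.) -/
structure EPA (N : Network) where
  /-- the delay function `d` -/
  delay : DelayFunction N
  /-- the stabilisation round `c` -/
  stab : ℕ
  /-- the cycle length `l` -/
  cycle : ℕ
  cycle_pos : 0 < cycle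
  periodic : ∀ i, stab ≤ i → ∀ (u : N.Node) (e : N.Edge), delay i u e = delay (i + cycle) u e

/-! ### Decision procedures and their running time -/

/-- What a procedure does in one state: halt with an answer, make one step of internal
computation, or evaluate the delay function at one triple `(j, v, e)` and branch on the result. -/
inductive Action (N : Network) (Q : Type) : Type
  | halt (answer : Bool)
  | compute (next : Q)
  | query (j : ℕ) (v : N.Node) (e : N.Edge) (next : Bool → Q)

/-- A deterministic sequential procedure on inputs `(G, g₀, d, c, l)`. The network and the numbers
`c`, `l` are given to it outright; the delay function, an infinite object, is evaluated pointwise,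
at one step per evaluation. The state set is arbitrary and internal computation is not restricted,
so every machine model whose single step evaluates `d` at most once is included. -/
structure Procedure where
  /-- internal states (memory contents, control state, …) -/
  State : Type
  /-- the initial state on a network, stabilisation round `c` and cycle length `l` -/
  init : Network → ℕ → ℕ → State
  /-- the action taken in a state -/
  act : (N : Network) → State → Action N State

namespace Procedure

/-- One step of the procedure; halting states are final. -/
def step (P : Procedure) (d : DelayFunction N) (q : P.State) : P.State :=
  match P.act N q with
  | .halt _ => q
  | .compute q' => q'
  | .query j v e k => k (d j v e)

/-- The state of the procedure after `t` steps on the input `A`. -/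
def stateAfter (P : Procedure) (A : EPA N) (t : ℕ) : P.State :=
  (P.step A.delay)^[t] (P.init N A.stab A.cycle)

/-- After `t` steps on the input `A`, the procedure has halted with answer `b`. -/
def HaltedWith (P : Procedure) (A : EPA N) (t : ℕ) (b : Bool) : Prop :=
  P.act N (P.stateAfter A t) = .halt b

/-- The running time: the number of steps until the procedure halts. -/
noncomputable def time (P : Procedure) (A : EPA N) : ℕ :=
  sInf {t | ∃ b, P.HaltedWith A t b}

/-- `P` decides EPA-RDAF termination: on every network and every eventually periodic adversary
with the finite delay property it halts, with answer `true` if and only if flooding terminates. -/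
def DecidesTermination (P : Procedure) : Prop :=
  ∀ (N : Network) (A : EPA N), A.delay.FiniteDelay →
    ∃ (t : ℕ) (b : Bool), P.HaltedWith A t b ∧ (b = true ↔ Terminates A.delay)

end Procedure

end RDAF

namespace RDAF

/-! ### The query lower bound -/

namespace Procedure

variable {N : Network}

/-! An adversary argument. On the base input the source holds the message back until round `c + l -
1` and then releases it to all neighbours at once; on the chosen graphs the flood then dies out. For
each early round `j` and suitable neighbour `x`, a variant also releases to `x` in round `j`. The
message travels around a cycle and returns to the source while it still holds its delayed copies. On
receipt the source recomputes its destinations, so those copies are lost, only `x` remains, and a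
message circulates forever.

Variants for different `(j, x)` differ from the base input on disjoint sets of triples, so a correct
procedure must evaluate a separate triple for each (`Procedure.card_le_time`), which costs about `c
+ l` steps per neighbour. Parallel paths of length two give about `m / 2` such neighbours
(`IsTheta.exists_time_ge`); `m = 3` is handled by the triangle (`IsTriangle.exists_time_ge`). -/

theorem HaltedWith.succ {P : Procedure} {A : EPA N} {t : ℕ} {b : Bool}
    (h : P.HaltedWith A t b) : P.HaltedWith A (t + 1) b := by
  unfold HaltedWith stateAfter at *
  rw [Function.iterate_succ_apply']
  generalize (P.step A.delay)^[t] (P.init N A.stab A.cycle) = q at *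
  have : P.step A.delay q = q := by simp [step, h]
  rw [this, h]

theorem HaltedWith.mono {P : Procedure} {A : EPA N} {t t' : ℕ} {b : Bool}
    (h : P.HaltedWith A t b) (ht : t ≤ t') : P.HaltedWith A t' b := by
  induction t', ht using Nat.le_induction with
  | base => exact h
  | succ _ _ ih => exact ih.succ

theorem HaltedWith.unique {P : Procedure} {A : EPA N} {t t' : ℕ} {b b' : Bool}
    (h : P.HaltedWith A t b) (h' : P.HaltedWith A t' b') : b = b' := by
  have h₁ := h.mono (le_max_left t t')
  have h₂ := h'.mono (le_max_right t t')
  unfold HaltedWith at h₁ h₂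
  rw [h₁] at h₂
  exact Action.halt.inj h₂

/-- In step `t` on input `A`, the procedure evaluates the delay function at `(j, v, e)`. -/
def QueriesAt (P : Procedure) (A : EPA N) (t j : ℕ) (v : N.Node) (e : N.Edge) : Prop :=
  ∃ k, P.act N (P.stateAfter A t) = .query j v e k

theorem QueriesAt.unique {P : Procedure} {A : EPA N} {t j j' : ℕ} {v v' : N.Node}
    {e e' : N.Edge} (h : P.QueriesAt A t j v e) (h' : P.QueriesAt A t j' v' e') :
    j = j' ∧ v = v' ∧ e = e' := by
  obtain ⟨k, hk⟩ := h
  obtain ⟨k', hk'⟩ := h'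
  rw [hk] at hk'
  injection hk' with h₁ h₂ h₃
  exact ⟨h₁, h₂, h₃⟩

/-- Two inputs that agree on all evaluated triples are not distinguished. -/
theorem stateAfter_eq (P : Procedure) {A B : EPA N} (hs : B.stab = A.stab)
    (hc : B.cycle = A.cycle) {T : ℕ}
    (h : ∀ t < T, ∀ j v e, P.QueriesAt A t j v e → A.delay j v e = B.delay j v e) :
    ∀ t ≤ T, P.stateAfter B t = P.stateAfter A t := by
  intro t
  induction t with
  | zero => intro _; simp [stateAfter, hs, hc]
  | succ t ih =>
    intro ht
    have ih' := ih (by omega)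
    have hq := h t (by omega)
    have hA : P.stateAfter A (t + 1) = P.step A.delay (P.stateAfter A t) :=
      Function.iterate_succ_apply' _ _ _
    have hB : P.stateAfter B (t + 1) = P.step B.delay (P.stateAfter B t) :=
      Function.iterate_succ_apply' _ _ _
    rw [hA, hB, ih']
    unfold step
    cases hact : P.act N (P.stateAfter A t) with
    | halt b => rfl
    | compute q => rfl
    | query j v e k => simp only [hq j v e ⟨k, hact⟩]

/-- A decision procedure needs, on an input `A`, at least one step for each of a family of inputs
with the opposite answer that differ from `A` on pairwise disjoint sets of triples. -/
theorem card_le_time {P : Procedure} (hP : P.DecidesTermination) {A : EPA N}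
    (hA : A.delay.FiniteDelay) {ι : Type*} (S : Finset ι) (B : ι → EPA N)
    (hstab : ∀ i ∈ S, (B i).stab = A.stab) (hcycle : ∀ i ∈ S, (B i).cycle = A.cycle)
    (hfin : ∀ i ∈ S, (B i).delay.FiniteDelay)
    (hans : ∀ i ∈ S, ¬ (Terminates (B i).delay ↔ Terminates A.delay))
    (hdisj : ∀ i ∈ S, ∀ i' ∈ S, ∀ j v e, A.delay j v e ≠ (B i).delay j v e →
      A.delay j v e ≠ (B i').delay j v e → i = i') :
    S.card ≤ P.time A := by
  classical
  obtain ⟨b, hb⟩ : ∃ b, P.HaltedWith A (P.time A) b := by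
    obtain ⟨t, b, h, -⟩ := hP N A hA
    -- The procedure halts on `A`, so the infimum is attained and is not the default value of `sInf
    -- ∅`.
    exact Nat.sInf_mem (s := {t | ∃ b, P.HaltedWith A t b}) ⟨t, b, h⟩
  have hbA : b = true ↔ Terminates A.delay := by
    obtain ⟨t, b', h, h'⟩ := hP N A hA
    rw [hb.unique h, h']
  have key : ∀ i ∈ S, ∃ t < P.time A, ∃ j v e, P.QueriesAt A t j v e ∧
      A.delay j v e ≠ (B i).delay j v e := by
    intro i hi
    by_contra! hcon
    have hEq := P.stateAfter_eq (hstab i hi) (hcycle i hi) hcon _ le_rfl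
    have hbB : P.HaltedWith (B i) (P.time A) b := by
      unfold HaltedWith at hb ⊢
      rw [hEq, hb]
    obtain ⟨t, b', h, h'⟩ := hP N (B i) (hfin i hi)
    rw [← hbB.unique h] at h'
    exact hans i hi (h'.symm.trans hbA)
  choose! f hf g using key
  -- One step evaluates only one triple, and that triple lies in at most one difference set, so
  -- distinct variants are detected at distinct steps.
  have := Finset.card_le_card_of_injOn (s := S) (t := Finset.range (P.time A)) f
    (fun i hi => by simpa using hf i hi) (by
      intro i hi i' hi' h
      obtain ⟨j, v, e, hq, hne⟩ := g i hi
      obtain ⟨j', v', e', hq', hne'⟩ := g i' hi'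
      rw [← h] at hq'
      obtain ⟨rfl, rfl, rfl⟩ := hq.unique hq'
      exact hdisj i hi i' hi' _ _ _ hne hne')
  simpa using this

end Procedure

/-! ### Destination dynamics -/

section Dynamics

variable {N : Network}

theorem hasMsg_of_mem_dest (d : DelayFunction N) (t : ℕ) {u v : N.Node}
    (h : v ∈ (state d t u).dest) : (state d t u).hasMsg := by
  cases t with
  | zero => exact h.1
  | succ t =>
    simp only [state, nextState] at h ⊢
    split_ifs at h with h'
    · exact Or.inr h'
    · exact Or.inl ⟨v, h⟩

theorem hasMsg_succ_false (d : DelayFunction N) (t : ℕ)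
    (h : ∀ u v, v ∉ (state d t u).dest) (u : N.Node) : ¬ (state d (t + 1) u).hasMsg := by
  simp [state, nextState, pending, received, Set.Nonempty, h]

theorem terminates_of_dest_empty (d : DelayFunction N) (t : ℕ)
    (h : ∀ u v, v ∉ (state d t u).dest) : Terminates d :=
  ⟨t + 1, hasMsg_succ_false d t h⟩

/-- A round without messages is followed only by such rounds, so it suffices to find destinations in
all late rounds. -/
theorem not_terminates_of_dest (d : DelayFunction N) (t₀ : ℕ)
    (h : ∀ t, t₀ ≤ t → ∃ u v, v ∈ (state d t u).dest) : ¬ Terminates d := by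
  rintro ⟨t, ht⟩
  have key : ∀ t', t ≤ t' → ∀ u, ¬ (state d t' u).hasMsg := by
    intro t' h'
    induction t', h' using Nat.le_induction with
    | base => exact ht
    | succ t' _ ih =>
      exact hasMsg_succ_false d t' fun u v hv => ih u (hasMsg_of_mem_dest d t' hv)
  obtain ⟨u, v, huv⟩ := h (max t t₀) (le_max_right _ _)
  exact key _ (le_max_left _ _) u (hasMsg_of_mem_dest d _ huv)

open Classical in
/-- The delay function that blocks only transmissions from the source, and lets the transmission to
`u` pass in round `j` exactly if `F j u`. -/
noncomputable def holdDelay (N : Network) (F : ℕ → N.Node → Prop) : DelayFunction N :=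
  fun j v e => decide (v = N.source ∧ ∀ u, e.1 = s(N.source, u) → ¬ F j u)

theorem holdDelay_eq_true {F : ℕ → N.Node → Prop} {j : ℕ} {v u : N.Node}
    (h : N.graph.Adj v u) :
    holdDelay N F j v ⟨s(v, u), h⟩ = true ↔ v = N.source ∧ ¬ F j u := by
  simp only [holdDelay, decide_eq_true_eq]
  constructor
  · rintro ⟨rfl, h'⟩
    exact ⟨rfl, h' u rfl⟩
  · rintro ⟨rfl, h'⟩
    refine ⟨rfl, fun w hw => ?_⟩
    rwa [← Sym2.congr_right.1 hw]

theorem blocked_holdDelay {F : ℕ → N.Node → Prop} {j : ℕ} {v u : N.Node} :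
    (holdDelay N F).Blocked j v u ↔ N.graph.Adj v u ∧ v = N.source ∧ ¬ F j u := by
  constructor
  · rintro ⟨h, h'⟩
    exact ⟨h, (holdDelay_eq_true h).1 h'⟩
  · rintro ⟨h, h'⟩
    exact ⟨h, (holdDelay_eq_true h).2 h'⟩

theorem allowed_holdDelay {F : ℕ → N.Node → Prop} {j : ℕ} {v u : N.Node} :
    (holdDelay N F).Allowed j v u ↔ N.graph.Adj v u ∧ (v = N.source → F j u) := by
  have key (h : N.graph.Adj v u) :
      holdDelay N F j v ⟨s(v, u), h⟩ = false ↔ (v = N.source → F j u) := by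
    rw [← Bool.not_eq_true, holdDelay_eq_true]
    tauto
  constructor
  · rintro ⟨h, h'⟩
    exact ⟨h, (key h).1 h'⟩
  · rintro ⟨h, h'⟩
    exact ⟨h, (key h).2 h'⟩

/-- `R u v` says exactly when `v` is a destination of `u` in round `t`. -/
def DestIs (d : DelayFunction N) (t : ℕ) (R : N.Node → N.Node → Prop) : Prop :=
  ∀ u v, v ∈ (state d t u).dest ↔ R u v

theorem destIs_zero (d : DelayFunction N) :
    DestIs d 0 fun u v => u = N.source ∧ N.graph.Adj u v := fun _ _ => Iff.rfl

/-- One round under `holdDelay`, for receiving and for non-receiving nodes. -/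
theorem DestIs.succ {F : ℕ → N.Node → Prop} {t : ℕ} {R R' : N.Node → N.Node → Prop}
    (h : DestIs (holdDelay N F) t R) (hR : ∀ u v, R u v → N.graph.Adj u v)
    (hrec : ∀ u, (∃ w, R w u ∧ (w = N.source → F (t + 1) u)) →
      ∀ v, R' u v ↔ N.graph.Adj u v ∧ ¬ (R v u ∧ (v = N.source → F (t + 1) u)))
    (hpend : ∀ u, (¬ ∃ w, R w u ∧ (w = N.source → F (t + 1) u)) →
      ∀ v, R' u v ↔ R u v ∧ u = N.source ∧ ¬ F (t + 1) v) :
    DestIs (holdDelay N F) (t + 1) R' := by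
  intro u v
  have hmem (w : N.Node) : w ∈ received (holdDelay N F) t (state (holdDelay N F) t) u ↔
      R w u ∧ (w = N.source → F (t + 1) u) := by
    simp only [received, Set.mem_ofPred_eq, allowed_holdDelay, h w u]
    have := hR w u
    tauto
  have hne : (received (holdDelay N F) t (state (holdDelay N F) t) u).Nonempty ↔
      ∃ w, R w u ∧ (w = N.source → F (t + 1) u) := by
    simp only [Set.Nonempty, hmem]
  simp only [state, nextState]
  split_ifs with h'
  · rw [Set.mem_sdiff, hmem, hrec u (hne.1 h') v]
    rfl
  · rw [hpend u (mt hne.2 h') v]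
    simp only [pending, Set.mem_ofPred_eq, blocked_holdDelay, h u v]
    have := hR u v
    tauto

end Dynamics

/-! ### The delay schedules -/

/-- The representative of a round below `c + l`, for stabilisation round `c` and cycle length
`l`. -/
def foldRound (c l j : ℕ) : ℕ := if j < c then j else c + (j - c) % l

theorem foldRound_add {c l j : ℕ} (h : c ≤ j) : foldRound c l (j + l) = foldRound c l j := by
  have h₁ : ¬ j < c := by omega
  have h₂ : ¬ j + l < c := by omega
  have h₃ : j + l - c = j - c + l := by omega
  simp [foldRound, h₁, h₂, h₃]

theorem foldRound_of_lt {c l j : ℕ} (h : j < c + l) : foldRound c l j = j := by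
  unfold foldRound
  split_ifs with h'
  · rfl
  · rw [Nat.mod_eq_of_lt (by omega)]
    omega

theorem foldRound_add_mul {c l j : ℕ} (h : c ≤ j) (k : ℕ) :
    foldRound c l (j + k * l) = foldRound c l j := by
  induction k with
  | zero => simp
  | succ k ih => rw [Nat.succ_mul, ← add_assoc, foldRound_add (by omega), ih]

section Schedules

variable (N : Network) (c l : ℕ) (hl : 1 ≤ l)

/-- The adversary that holds the message at the source, except in the rounds with representative
`c + l - 1`, and lets the transmission to `x` pass also in the rounds with representative `j`
whenever `E j x`. -/
noncomputable def holdEPA (E : ℕ → N.Node → Prop) : EPA N where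
  delay := holdDelay N fun j u => foldRound c l j = c + l - 1 ∨ E (foldRound c l j) u
  stab := c
  cycle := l
  cycle_pos := hl
  periodic := by
    intro i hi u e
    have h := foldRound_add (l := l) hi
    simp only [holdDelay, h, decide_eq_decide]

/-- The general release at `c + l - 1` recurs every `l` rounds, whatever `E` is. -/
theorem holdEPA_finiteDelay (E : ℕ → N.Node → Prop) :
    (holdEPA N c l hl E).delay.FiniteDelay := by
  intro v u h t
  have hf : foldRound c l (c + l - 1 + t * l) = c + l - 1 := by
    rw [foldRound_add_mul (by omega), foldRound_of_lt (by omega)]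
  refine ⟨c + l - 1 + t * l, ?_, allowed_holdDelay.2 ⟨h, fun _ => Or.inl hf⟩⟩
  have := Nat.le_mul_of_pos_right t hl
  omega

variable {N c l}

/-- If holding back all messages until round `c + l - 1` leads to termination, and one early
release in a round of `[1, r)` to a node of `X` does not, then `(r - 1) * |X|` steps are needed. -/
theorem exists_time_ge {P : Procedure} (hP : P.DecidesTermination) (r : ℕ) (X : Finset N.Node)
    (hterm : Terminates (holdEPA N c l hl fun _ _ => False).delay)
    (hnon : ∀ j ∈ Finset.Ico 1 r, ∀ x ∈ X,
      ¬ Terminates (holdEPA N c l hl fun j' u => j' = j ∧ u = x).delay) :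
    (r - 1) * X.card ≤ P.time (holdEPA N c l hl fun _ _ => False) := by
  have hdiff : ∀ (i : ℕ × N.Node) j v e, (holdEPA N c l hl fun _ _ => False).delay j v e ≠
      (holdEPA N c l hl fun j' u => j' = i.1 ∧ u = i.2).delay j v e →
      foldRound c l j = i.1 ∧ e.1 = s(N.source, i.2) := by
    intro i j v e h
    by_contra hcon
    refine h ?_
    simp only [holdEPA, holdDelay, or_false, decide_eq_decide]
    refine and_congr_right fun _ => forall_congr' fun u => forall_congr' fun hu => ?_
    refine not_congr ⟨Or.inl, ?_⟩
    rintro (h | ⟨h, rfl⟩)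
    · exact h
    · exact absurd ⟨h, hu⟩ hcon
  have := Procedure.card_le_time hP (holdEPA_finiteDelay N c l hl fun _ _ => False)
    -- Rounds start at 1, since the protocol never consults the delay function in round 0.
    (Finset.Ico 1 r ×ˢ X) (fun i => holdEPA N c l hl fun j' u => j' = i.1 ∧ u = i.2)
    (fun _ _ => rfl) (fun _ _ => rfl) (fun _ _ => holdEPA_finiteDelay N c l hl _)
    (fun i hi => by
      rw [Finset.mem_product] at hi
      have := hnon i.1 hi.1 i.2 hi.2
      tauto)
    (fun i _ i' _ j v e h h' => by
      obtain ⟨h₁, h₂⟩ := hdiff i j v e h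
      obtain ⟨h₁', h₂'⟩ := hdiff i' j v e h'
      exact Prod.ext (h₁.symm.trans h₁') (Sym2.congr_right.1 (h₂.symm.trans h₂')))
  simpa using this

/-- Until the first release, the source keeps all its destinations. -/
theorem destIs_of_lt {E : ℕ → N.Node → Prop} {t : ℕ} (ht : t + 1 < c + l)
    (hE : ∀ j u, 1 ≤ j → j ≤ t → ¬ E j u) :
    DestIs (holdEPA N c l hl E).delay t fun u v => u = N.source ∧ N.graph.Adj u v := by
  induction t with
  | zero => exact destIs_zero _
  | succ t ih =>
    have hF : ∀ u, ¬ (foldRound c l (t + 1) = c + l - 1 ∨ E (foldRound c l (t + 1)) u) := by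
      intro u
      rw [foldRound_of_lt (by omega)]
      have := hE (t + 1) u (by omega) le_rfl
      rintro (h | h)
      · omega
      · exact this h
    refine DestIs.succ (ih (by omega) fun j u h₁ h₂ => hE j u h₁ (by omega))
      (fun _ _ h => h.2) ?_ ?_
    · rintro u ⟨w, hw, hw'⟩
      exact absurd (hw' hw.1) (hF u)
    · intro u _ v
      have := hF v
      tauto

end Schedules

/-! ### Parallel paths of length two -/

/-- The source and the node `h` are joined by the paths of length two through the nodes of `X`, and
the nodes of `Q` are pendant at `h`. -/
structure IsTheta (N : Network) (h : N.Node) (X Q : N.Node → Prop) : Prop where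
  adj : ∀ u v, N.graph.Adj u v ↔ (u = N.source ∧ X v) ∨ (X u ∧ v = N.source) ∨
    (u = h ∧ (X v ∨ Q v)) ∨ ((X u ∨ Q u) ∧ v = h)
  source_ne : N.source ≠ h
  source_X : ¬ X N.source
  hub_X : ¬ X h
  source_Q : ¬ Q N.source
  hub_Q : ¬ Q h
  disj : ∀ u, X u → ¬ Q u

namespace IsTheta

variable {N : Network} {h : N.Node} {X Q : N.Node → Prop}
  {F : ℕ → N.Node → Prop} {t : ℕ}

/-- All paths deliver to `h` in the same round, so `h` forwards only to the pendant nodes, where the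
message dies. -/
theorem terminates (T : IsTheta N h X Q) (hX : ∃ x, X x)
    (h₀ : DestIs (holdDelay N F) t fun u v => u = N.source ∧ N.graph.Adj u v)
    (hF : ∀ u, F (t + 1) u) : Terminates (holdDelay N F) := by
  obtain ⟨adj, hgh, hXg, hXh, hQg, hQh, hXQ⟩ := T
  obtain ⟨x, hx⟩ := hX
  have h₁ : DestIs (holdDelay N F) (t + 1) fun u v => X u ∧ v = h :=
    h₀.succ (by grind) (by grind) (by grind)
  have h₂ : DestIs (holdDelay N F) (t + 2) fun u v => u = h ∧ Q v :=
    h₁.succ (by grind) (by grind) (by grind)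
  have h₃ : DestIs (holdDelay N F) (t + 3) fun _ _ => False :=
    h₂.succ (by grind) (by grind) (by grind)
  exact terminates_of_dest_empty _ (t + 3) fun u v => (h₃ u v).1

variable {x : N.Node}

/-- The message circulates: to `h` along the path through `x`, back along all others. -/
theorem not_terminates_of_circulating (T : IsTheta N h X Q) (hx : X x) (hX : ∃ y, X y ∧ y ≠ x)
    (h₀ : DestIs (holdDelay N F) t fun u v => u = N.source ∧ v = x) :
    ¬ Terminates (holdDelay N F) := by
  obtain ⟨adj, hgh, hXg, hXh, hQg, hQh, hXQ⟩ := T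
  obtain ⟨y, hy, hyx⟩ := hX
  have key : ∀ s, t ≤ s →
      DestIs (holdDelay N F) s (fun u v => u = N.source ∧ v = x) ∨
      DestIs (holdDelay N F) s (fun u v => u = x ∧ v = h) ∨
      DestIs (holdDelay N F) s (fun u v => u = h ∧ ((X v ∧ v ≠ x) ∨ Q v)) ∨
      DestIs (holdDelay N F) s (fun u v => X u ∧ u ≠ x ∧ v = N.source) := by
    intro s hs
    induction s, hs using Nat.le_induction with
    | base => exact Or.inl h₀
    | succ s _ ih =>
      rcases ih with ih | ih | ih | ih
      · by_cases hF : F (s + 1) x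
        · exact Or.inr (Or.inl (ih.succ (by grind) (by grind) (by grind)))
        · exact Or.inl (ih.succ (by grind) (by grind) (by grind))
      · exact Or.inr (Or.inr (Or.inl (ih.succ (by grind) (by grind) (by grind))))
      · exact Or.inr (Or.inr (Or.inr (ih.succ (by grind) (by grind) (by grind))))
      · exact Or.inl (ih.succ (by grind) (by grind) (by grind))
  refine not_terminates_of_dest _ t fun s hs => ?_
  rcases key s hs with k | k | k | k
  · exact ⟨_, _, (k _ _).2 ⟨rfl, rfl⟩⟩
  · exact ⟨_, _, (k _ _).2 ⟨rfl, rfl⟩⟩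
  · exact ⟨_, _, (k _ _).2 ⟨rfl, Or.inl ⟨hy, hyx⟩⟩⟩
  · exact ⟨_, _, (k _ _).2 ⟨hy, hyx, rfl⟩⟩

/-- The four rounds are one trip from the source through `x` to `h` and back along the other paths.
Later rounds are unconstrained: delays only make the circulating message wait at the source. -/
theorem not_terminates (T : IsTheta N h X Q) (hx : X x) (hX : ∃ y, X y ∧ y ≠ x)
    (h₀ : DestIs (holdDelay N F) t fun u v => u = N.source ∧ N.graph.Adj u v)
    (hF : ∀ u, F (t + 1) u ↔ u = x) (hF₂ : ∀ u, ¬ F (t + 2) u) (hF₃ : ∀ u, ¬ F (t + 3) u)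
    (hF₄ : ∀ u, ¬ F (t + 4) u) : ¬ Terminates (holdDelay N F) := by
  have T' := T
  obtain ⟨adj, hgh, hXg, hXh, hQg, hQh, hXQ⟩ := T'
  have h₁ : DestIs (holdDelay N F) (t + 1) fun u v =>
      (u = x ∧ v = h) ∨ (u = N.source ∧ X v ∧ v ≠ x) :=
    h₀.succ (by grind) (by grind) (by grind)
  have h₂ : DestIs (holdDelay N F) (t + 2) fun u v =>
      (u = h ∧ ((X v ∧ v ≠ x) ∨ Q v)) ∨ (u = N.source ∧ X v ∧ v ≠ x) :=
    h₁.succ (by grind) (by grind) (by grind)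
  have h₃ : DestIs (holdDelay N F) (t + 3) fun u v =>
      (X u ∧ u ≠ x ∧ v = N.source) ∨ (u = N.source ∧ X v ∧ v ≠ x) :=
    h₂.succ (by grind) (by grind) (by grind)
  -- All neighbours of the source but `x` deliver at once, which erases the delayed copies.
  have h₄ : DestIs (holdDelay N F) (t + 4) fun u v => u = N.source ∧ v = x :=
    h₃.succ (by grind) (by grind) (by grind)
  exact T.not_terminates_of_circulating hx hX h₄

theorem exists_time_ge (T : IsTheta N h X Q) {c l : ℕ} (hl : 1 ≤ l) (hcl : 5 ≤ c + l)
    {P : Procedure} (hP : P.DecidesTermination) (S : Finset N.Node)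
    (hS : ∀ u, u ∈ S ↔ X u) (hcard : 2 ≤ S.card) :
    (c + l - 5) * S.card ≤ P.time (holdEPA N c l hl fun _ _ => False) := by
  -- An early release in round `j` needs rounds `j + 1` to `j + 3` free of releases, hence `j + 3 <
  -- c + l - 1`.
  refine RDAF.exists_time_ge hl hP (c + l - 4) S ?_ ?_
  · obtain ⟨x, hx⟩ := Finset.card_pos.1 (by omega : 0 < S.card)
    refine T.terminates (t := c + l - 2) ⟨x, (hS x).1 hx⟩
      (destIs_of_lt hl (by omega) fun _ _ _ _ => id) fun u => Or.inl ?_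
    rw [foldRound_of_lt (by omega)]
    omega
  · intro j hj x hx
    rw [Finset.mem_Ico] at hj
    obtain ⟨y, hy, hyx⟩ := Finset.exists_mem_ne (by omega : 1 < S.card) x
    obtain ⟨t, rfl⟩ : ∃ t, j = t + 1 := ⟨j - 1, by omega⟩
    have hno : ∀ k u, 2 ≤ k → k ≤ 4 →
        ¬ (foldRound c l (t + k) = c + l - 1 ∨ foldRound c l (t + k) = t + 1 ∧ u = x) := by
      intro k u h₁ h₂
      rw [foldRound_of_lt (by omega)]
      omega
    refine T.not_terminates (t := t) ((hS x).1 hx) ⟨y, (hS y).1 hy, hyx⟩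
      (destIs_of_lt (c := c) (E := fun j' u => j' = t + 1 ∧ u = x) hl (by omega)
        fun j u h₁ h₂ h₃ => by omega) (fun u => ?_)
      (fun u => hno 2 u (by omega) (by omega)) (fun u => hno 3 u (by omega) (by omega))
      (fun u => hno 4 u (by omega) (by omega))
    rw [foldRound_of_lt (by omega)]
    have : t + 1 ≠ c + l - 1 := by omega
    tauto

end IsTheta

/-- The graph with `r` paths of length two between `0` and `1`, and `q` nodes pendant at `1`. -/
def thetaGraph (r q : ℕ) : SimpleGraph (Fin (r + q + 2)) where
  Adj u v := (u.1 = 0 ∧ 2 ≤ v.1 ∧ v.1 < r + 2) ∨ (2 ≤ u.1 ∧ u.1 < r + 2 ∧ v.1 = 0) ∨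
    (u.1 = 1 ∧ 2 ≤ v.1) ∨ (2 ≤ u.1 ∧ v.1 = 1)
  symm := ⟨by intro u v h; omega⟩
  loopless := ⟨by intro u h; omega⟩

/-- Adjacency in the shape that `IsTheta.adj` demands. -/
theorem thetaGraph_adj (r q : ℕ) (u v : Fin (r + q + 2)) : (thetaGraph r q).Adj u v ↔
    (u = ⟨0, by omega⟩ ∧ 2 ≤ v.1 ∧ v.1 < r + 2) ∨ ((2 ≤ u.1 ∧ u.1 < r + 2) ∧ v = ⟨0, by omega⟩) ∨
    (u = ⟨1, by omega⟩ ∧ ((2 ≤ v.1 ∧ v.1 < r + 2) ∨ r + 2 ≤ v.1)) ∨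
    (((2 ≤ u.1 ∧ u.1 < r + 2) ∨ r + 2 ≤ u.1) ∧ v = ⟨1, by omega⟩) := by
  simp only [thetaGraph, Fin.ext_iff]
  omega

theorem thetaGraph_connected (r q : ℕ) (hr : 1 ≤ r) : (thetaGraph r q).Connected := by
  rw [SimpleGraph.connected_iff_exists_forall_reachable]
  refine ⟨⟨1, by omega⟩, fun w => ?_⟩
  have key : ∀ w : Fin (r + q + 2), 2 ≤ w.1 → (thetaGraph r q).Reachable ⟨1, by omega⟩ w :=
    fun w hw => SimpleGraph.Adj.reachable (Or.inr (Or.inr (Or.inl ⟨rfl, hw⟩)))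
  rcases (by omega : w.1 = 0 ∨ w.1 = 1 ∨ 2 ≤ w.1) with h | h | h
  · refine (key ⟨2, by omega⟩ le_rfl).trans (SimpleGraph.Adj.reachable ?_)
    exact Or.inr (Or.inl ⟨le_rfl, by simp; omega, h⟩)
  · rw [show w = ⟨1, by omega⟩ from Fin.ext h]
  · exact key w h

theorem thetaGraph_ncard_edgeSet (r q : ℕ) : (thetaGraph r q).edgeSet.ncard = 2 * r + q := by
  -- The first `r` indices enumerate the edges at `0`, the remaining `r + q` those at `1`.
  let f : Fin (2 * r + q) → Sym2 (Fin (r + q + 2)) := fun k =>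
    if h : k.1 < r then s(⟨0, by omega⟩, ⟨k.1 + 2, by omega⟩)
    else s(⟨1, by omega⟩, ⟨k.1 - r + 2, by omega⟩)
  have hf : Function.Injective f := by
    intro k k' h
    simp only [f] at h
    split_ifs at h <;> simp [Fin.ext_iff] at h <;> omega
  have hrange : (thetaGraph r q).edgeSet = Set.range f := by
    ext e
    induction e using Sym2.ind with
    | _ u v =>
      rw [SimpleGraph.mem_edgeSet]
      constructor
      · have hu : u.1 < r + q + 2 := u.2
        have hv : v.1 < r + q + 2 := v.2
        rintro (⟨h, h', h''⟩ | ⟨h, h', h''⟩ | ⟨h, h'⟩ | ⟨h, h'⟩)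
        · refine ⟨⟨v.1 - 2, by omega⟩, ?_⟩
          simp only [f]
          rw [dif_pos (by omega), Sym2.eq_iff]
          exact Or.inl ⟨Fin.ext (by simp; omega), Fin.ext (by simp; omega)⟩
        · refine ⟨⟨u.1 - 2, by omega⟩, ?_⟩
          simp only [f]
          rw [dif_pos (by omega), Sym2.eq_iff]
          exact Or.inr ⟨Fin.ext (by simp; omega), Fin.ext (by simp; omega)⟩
        · refine ⟨⟨v.1 - 2 + r, by omega⟩, ?_⟩
          simp only [f]
          rw [dif_neg (by simp), Sym2.eq_iff]
          exact Or.inl ⟨Fin.ext (by simp; omega), Fin.ext (by simp; omega)⟩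
        · refine ⟨⟨u.1 - 2 + r, by omega⟩, ?_⟩
          simp only [f]
          rw [dif_neg (by simp), Sym2.eq_iff]
          exact Or.inr ⟨Fin.ext (by simp; omega), Fin.ext (by simp; omega)⟩
      · rintro ⟨k, hk⟩
        rw [← SimpleGraph.mem_edgeSet, ← hk]
        simp only [f]
        split_ifs with h
        · exact Or.inl ⟨rfl, by simp, by simpa using h⟩
        · exact Or.inr (Or.inr (Or.inl ⟨rfl, by simp⟩))
  rw [hrange, ← Set.image_univ, Set.ncard_image_of_injective _ hf,
    Set.ncard_univ, Nat.card_fin]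

/-- The network on `thetaGraph r q` with source `0`. -/
def thetaNetwork (r q : ℕ) (hr : 1 ≤ r) : Network where
  n := r + q + 2
  graph := thetaGraph r q
  connected := thetaGraph_connected r q hr
  source := ⟨0, by omega⟩

theorem thetaNetwork_isTheta (r q : ℕ) (hr : 1 ≤ r) :
    IsTheta (thetaNetwork r q hr) (⟨1, by omega⟩ : Fin (r + q + 2))
      (fun u => 2 ≤ u.1 ∧ u.1 < r + 2) (fun u => r + 2 ≤ u.1) where
  adj := thetaGraph_adj r q
  source_ne := by simp [thetaNetwork]
  source_X := by simp [thetaNetwork]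
  hub_X := by simp
  source_Q := by simp [thetaNetwork]
  hub_Q := by simp
  disj u h := by omega

theorem thetaNetwork_exists_finset (r q : ℕ) (hr : 1 ≤ r) :
    ∃ S : Finset (thetaNetwork r q hr).Node, (∀ u, u ∈ S ↔ 2 ≤ u.1 ∧ u.1 < r + 2) ∧
      S.card = r := by
  refine ⟨(Finset.Ico 2 (r + 2)).attachFin (n := r + q + 2) fun k hk => ?_, fun u => ?_, ?_⟩
  · rw [Finset.mem_Ico] at hk
    omega
  · exact Finset.mem_attachFin _ |>.trans Finset.mem_Ico
  · exact (Finset.card_attachFin _ _).trans (by rw [Nat.card_Ico]; omega)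

/-! ### The triangle -/

/-- The triangle. -/
def triangleNetwork : Network where
  n := 3
  graph := ⊤
  connected := SimpleGraph.connected_top
  source := 0

theorem triangleNetwork_edgeCount : triangleNetwork.edgeCount = 3 := by
  change (⊤ : SimpleGraph (Fin 3)).edgeSet.ncard = 3
  rw [← SimpleGraph.coe_edgeFinset, Set.ncard_coe_finset,
    SimpleGraph.card_edgeFinset_top_eq_card_choose_two]
  decide

/-- The nodes of a triangle are the source, `x` and `y`. -/
structure IsTriangle (N : Network) (x y : N.Node) : Prop where
  adj : ∀ u v, N.graph.Adj u v ↔ u ≠ v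
  source_ne_left : N.source ≠ x
  source_ne_right : N.source ≠ y
  ne : x ≠ y
  cover : ∀ u, u = N.source ∨ u = x ∨ u = y

namespace IsTriangle

variable {N : Network} {x y : N.Node} {F : ℕ → N.Node → Prop} {t : ℕ}

/-- `DestIs.succ` with the quantifiers over nodes unfolded into the three cases, so that `grind` can
settle each round by case analysis. -/
theorem destIs_succ (T : IsTriangle N x y) {R R' : N.Node → N.Node → Prop}
    (h : DestIs (holdDelay N F) t R) (hR : ∀ u v, R u v → N.graph.Adj u v)
    (hrec : ∀ u v w, (u = N.source ∨ u = x ∨ u = y) → (v = N.source ∨ v = x ∨ v = y) →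
      R w u → (w = N.source → F (t + 1) u) →
      (R' u v ↔ N.graph.Adj u v ∧ ¬ (R v u ∧ (v = N.source → F (t + 1) u))))
    (hpend : ∀ u v, (u = N.source ∨ u = x ∨ u = y) → (v = N.source ∨ v = x ∨ v = y) →
      ¬ R x u → ¬ R y u → ¬ (R N.source u ∧ F (t + 1) u) →
      (R' u v ↔ R u v ∧ u = N.source ∧ ¬ F (t + 1) v)) :
    DestIs (holdDelay N F) (t + 1) R' :=
  h.succ hR (fun u ⟨w, hw, hw'⟩ v => hrec u v w (T.cover u) (T.cover v) hw hw')
    fun u hu v => hpend u v (T.cover u) (T.cover v)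
      (fun hx => hu ⟨x, hx, fun e => absurd e.symm T.source_ne_left⟩)
      (fun hy => hu ⟨y, hy, fun e => absurd e.symm T.source_ne_right⟩)
      (fun hs => hu ⟨_, hs.1, fun _ => hs.2⟩)

/-- The messages of `x` and `y` cross and reach the source together, leaving it no destination. -/
theorem terminates (T : IsTriangle N x y)
    (h₀ : DestIs (holdDelay N F) t fun u v => u = N.source ∧ N.graph.Adj u v)
    (hF : ∀ u, F (t + 1) u) : Terminates (holdDelay N F) := by
  have T' := T
  obtain ⟨adj, hgx, hgy, hxy, -⟩ := T'
  have h₁ : DestIs (holdDelay N F) (t + 1) fun u v => (u = x ∧ v = y) ∨ (u = y ∧ v = x) :=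
    T.destIs_succ h₀ (by grind) (by grind) (by grind)
  have h₂ : DestIs (holdDelay N F) (t + 2) fun u v => u ≠ N.source ∧ v = N.source :=
    T.destIs_succ h₁ (by grind) (by grind) (by grind)
  have h₃ : DestIs (holdDelay N F) (t + 3) fun _ _ => False :=
    T.destIs_succ h₂ (by grind) (by grind) (by grind)
  exact terminates_of_dest_empty _ (t + 3) fun u v => (h₃ u v).1

theorem not_terminates_of_circulating (T : IsTriangle N x y)
    (h₀ : DestIs (holdDelay N F) t fun u v => u = N.source ∧ v = x) :
    ¬ Terminates (holdDelay N F) := by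
  have T' := T
  obtain ⟨adj, hgx, hgy, hxy, -⟩ := T'
  have key : ∀ s, t ≤ s →
      DestIs (holdDelay N F) s (fun u v => u = N.source ∧ v = x) ∨
      DestIs (holdDelay N F) s (fun u v => u = x ∧ v = y) ∨
      DestIs (holdDelay N F) s (fun u v => u = y ∧ v = N.source) := by
    intro s hs
    induction s, hs using Nat.le_induction with
    | base => exact Or.inl h₀
    | succ s _ ih =>
      rcases ih with ih | ih | ih
      · by_cases hF : F (s + 1) x
        · exact Or.inr (Or.inl (T.destIs_succ ih (by grind) (by grind) (by grind)))
        · exact Or.inl (T.destIs_succ ih (by grind) (by grind) (by grind))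
      · exact Or.inr (Or.inr (T.destIs_succ ih (by grind) (by grind) (by grind)))
      · exact Or.inl (T.destIs_succ ih (by grind) (by grind) (by grind))
  refine not_terminates_of_dest _ t fun s hs => ?_
  rcases key s hs with k | k | k <;> exact ⟨_, _, (k _ _).2 ⟨rfl, rfl⟩⟩

/-- The message released to `x` returns through `y`; its arrival replaces the delayed copy for `y`
by a message for `x`, which then runs around the triangle. -/
theorem not_terminates (T : IsTriangle N x y)
    (h₀ : DestIs (holdDelay N F) t fun u v => u = N.source ∧ N.graph.Adj u v)
    (hF : ∀ u, F (t + 1) u ↔ u = x) (hF₂ : ∀ u, ¬ F (t + 2) u) (hF₃ : ∀ u, ¬ F (t + 3) u) :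
    ¬ Terminates (holdDelay N F) := by
  have T' := T
  obtain ⟨adj, hgx, hgy, hxy, -⟩ := T'
  have h₁ : DestIs (holdDelay N F) (t + 1) fun u v =>
      (u = x ∧ v = y) ∨ (u = N.source ∧ v = y) :=
    T.destIs_succ h₀ (by grind) (by grind) (by grind)
  have h₂ : DestIs (holdDelay N F) (t + 2) fun u v =>
      (u = y ∧ v = N.source) ∨ (u = N.source ∧ v = y) :=
    T.destIs_succ h₁ (by grind) (by grind) (by grind)
  have h₃ : DestIs (holdDelay N F) (t + 3) fun u v => u = N.source ∧ v = x :=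
    T.destIs_succ h₂ (by grind) (by grind) (by grind)
  exact T.not_terminates_of_circulating h₃

theorem exists_time_ge (T : IsTriangle N x y) {c l : ℕ} (hl : 1 ≤ l) (hcl : 5 ≤ c + l)
    {P : Procedure} (hP : P.DecidesTermination) :
    c + l - 5 ≤ P.time (holdEPA N c l hl fun _ _ => False) := by
  have := RDAF.exists_time_ge (c := c) hl hP (c + l - 4) {x} ?_ ?_
  · rw [Finset.card_singleton] at this
    omega
  · refine T.terminates (t := c + l - 2)
      (destIs_of_lt hl (by omega) fun _ _ _ _ => id) fun u => Or.inl ?_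
    rw [foldRound_of_lt (by omega)]
    omega
  · intro j hj x' hx'
    rw [Finset.mem_singleton] at hx'
    subst hx'
    rw [Finset.mem_Ico] at hj
    obtain ⟨t, rfl⟩ : ∃ t, j = t + 1 := ⟨j - 1, by omega⟩
    have hno : ∀ k u, 2 ≤ k → k ≤ 3 →
        ¬ (foldRound c l (t + k) = c + l - 1 ∨ foldRound c l (t + k) = t + 1 ∧ u = x') := by
      intro k u h₁ h₂
      rw [foldRound_of_lt (by omega)]
      omega
    refine T.not_terminates (t := t)
      (destIs_of_lt (c := c) (E := fun j' u => j' = t + 1 ∧ u = x') hl (by omega)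
        fun j u h₁ h₂ h₃ => by omega) (fun u => ?_)
      (fun u => hno 2 u (by omega) (by omega)) (fun u => hno 3 u (by omega) (by omega))
    rw [foldRound_of_lt (by omega)]
    have : t + 1 ≠ c + l - 1 := by omega
    tauto

end IsTriangle

theorem triangleNetwork_isTriangle :
    IsTriangle triangleNetwork (1 : Fin 3) (2 : Fin 3) where
  adj u v := SimpleGraph.top_adj u v
  source_ne_left := (by decide : (0 : Fin 3) ≠ 1)
  source_ne_right := (by decide : (0 : Fin 3) ≠ 2)
  ne := (by decide : (1 : Fin 3) ≠ 2)
  cover := (by decide : ∀ u : Fin 3, u = 0 ∨ u = 1 ∨ u = 2)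

end RDAF

/-! ### Assembling the bound for every number of edges -/

theorem mainTheorem9 :
    ∃ ε : ℝ, 0 < ε ∧ ∃ k₀ : ℕ,
      ∀ P : RDAF.Procedure, P.DecidesTermination →
        ∀ c l m : ℕ, 1 ≤ l → 3 ≤ m → k₀ ≤ c + l →
          ∃ (N : RDAF.Network) (A : RDAF.EPA N),
            A.delay.FiniteDelay ∧ A.stab = c ∧ A.cycle = l ∧ N.edgeCount = m ∧
              ε * (((c : ℝ) + (l : ℝ)) * (m : ℝ)) ≤ (P.time A : ℝ) := by
  -- The factor `1 / 6` combines `(c + l) / 2 ≤ c + l - 5`, valid from `c + l = 10` on, with `m ≤ 3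
  -- * (m / 2)` for the integer quotient.
  refine ⟨1 / 6, by norm_num, 10, fun P hP c l m hl hm hk => ?_⟩
  have hk' : (10 : ℝ) ≤ (c : ℝ) + l := by exact_mod_cast hk
  have hsub : ((c + l - 5 : ℕ) : ℝ) = (c : ℝ) + l - 5 := by
    rw [Nat.cast_sub (by omega)]
    push_cast
    ring
  -- For `m = 3` the quotient `m / 2` leaves a single path, but circulation needs a second one to
  -- return along.
  rcases hm.eq_or_lt with rfl | hm'
  · refine ⟨RDAF.triangleNetwork, RDAF.holdEPA _ c l hl fun _ _ => False,
      RDAF.holdEPA_finiteDelay _ c l hl _, rfl, rfl, RDAF.triangleNetwork_edgeCount, ?_⟩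
    have h : ((c + l - 5 : ℕ) : ℝ) ≤ _ := Nat.cast_le.2
      (RDAF.triangleNetwork_isTriangle.exists_time_ge (c := c) hl (by omega) hP)
    rw [hsub] at h
    push_cast
    linarith
  · have hr : 2 ≤ m / 2 := by omega
    refine ⟨RDAF.thetaNetwork (m / 2) (m % 2) (by omega),
      RDAF.holdEPA _ c l hl fun _ _ => False, RDAF.holdEPA_finiteDelay _ c l hl _, rfl, rfl, ?_, ?_⟩
    · exact (RDAF.thetaGraph_ncard_edgeSet _ _).trans (by omega)
    · obtain ⟨S, hS, hcard⟩ := RDAF.thetaNetwork_exists_finset (m / 2) (m % 2) (by omega)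
      have h := (RDAF.thetaNetwork_isTheta (m / 2) (m % 2) (by omega)).exists_time_ge
        (c := c) hl (by omega) hP
        S hS (hr.trans_eq hcard.symm)
      rw [hcard] at h
      have h' : (((c + l - 5) * (m / 2) : ℕ) : ℝ) ≤ _ := Nat.cast_le.2 h
      refine le_trans ?_ h'
      rw [Nat.cast_mul, hsub]
      have h₁ : (m : ℝ) ≤ 3 * ((m / 2 : ℕ) : ℝ) := by
        exact_mod_cast (by omega : m ≤ 3 * (m / 2))
      have h₂ : ((c : ℝ) + l) / 2 ≤ (c : ℝ) + l - 5 := by linarith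
      calc (1 / 6 : ℝ) * (((c : ℝ) + l) * m)
          ≤ 1 / 6 * (((c : ℝ) + l) * (3 * ((m / 2 : ℕ) : ℝ))) := by gcongr
        _ = ((c : ℝ) + l) / 2 * ((m / 2 : ℕ) : ℝ) := by ring
        _ ≤ _ := by gcongr
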